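/- Let $d\ge 2$ be an integer. Let $\mathcal{B}_d$ be the set of all closed, bounded, convex sets $B\subseteq\mathbb{R}^d$ with $B=-B$ and $\mathbf 0$ in the interior of $B$ (equivalently, the set of unit balls $\{\mathbf x : \|\mathbf x\|\le 1\}$ of norms $\|\cdot\|$ on $\mathbb{R}^d$), endowed with the Hausdorff metric induced by the Euclidean distance. Then there is a meagre set $\mathcal{M}\subseteq\mathcal{B}_d$ (that is, a countable union of nowhere dense subsets of $\mathcal{B}_d$) such that every norm $\|\cdot\|$ on $\mathbb{R}^d$ whose unit ball does not belong to $\mathcal{M}$ has the following property: for every integer $n\ge 1$ and every set $P\subseteq\mathbb{R}^d$ of $n$ points, the number of unordered pairs $\{\mathbf x,\mathbf y\}\subseteq P$ with $\|\mathbf x-\mathbf y\|=1$ is at most $\frac d2\, n\log_2 n$. -/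

import Mathlib

/-- A norm on `ℝ^d`: a seminorm that vanishes only at `0`. It is unrelated to the Euclidean norm
that `EuclideanSpace ℝ (Fin d)` carries. -/
structure DNorm (d : ℕ) extends Seminorm ℝ (EuclideanSpace ℝ (Fin d)) where
  eq_zero_of_map_eq_zero : ∀ x, toFun x = 0 → x = 0

/-- The closed, bounded, `0`-symmetric convex bodies in `ℝ^d` with `0` in the interior. As a subtype
of Mathlib's `ConvexBody` it carries the Hausdorff metric of the Euclidean distance. -/
abbrev SymmetricBody (d : ℕ) : Type :=
  {K : ConvexBody (EuclideanSpace ℝ (Fin d)) //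
    (∀ x ∈ K, -x ∈ K) ∧ (0 : EuclideanSpace ℝ (Fin d)) ∈ interior (K : Set (EuclideanSpace ℝ (Fin d)))}

namespace DNorm

variable {d : ℕ}

theorem continuous (N : DNorm d) : Continuous N.toSeminorm := by
  have h : ConvexOn ℝ Set.univ (N.toSeminorm : EuclideanSpace ℝ (Fin d) → ℝ) :=
    N.toSeminorm.convexOn
  exact continuousOn_univ.1 (h.continuousOn isOpen_univ)

theorem exists_pos_mul_norm_le (N : DNorm d) :
    ∃ c : ℝ, 0 < c ∧ ∀ x, c * ‖x‖ ≤ N.toSeminorm x := by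
  rcases (Metric.sphere (0 : EuclideanSpace ℝ (Fin d)) 1).eq_empty_or_nonempty with h | h
  · refine ⟨1, one_pos, fun x => ?_⟩
    by_cases hx : x = 0
    · simp [hx]
    · have : ‖x‖⁻¹ • x ∈ Metric.sphere (0 : EuclideanSpace ℝ (Fin d)) 1 := by
        simp [norm_smul, hx]
      simp [h] at this
  · obtain ⟨y, hy, hmin⟩ := (isCompact_sphere _ _).exists_isMinOn h N.continuous.continuousOn
    have hy0 : y ≠ 0 := by
      rintro rfl
      simp at hy
    refine ⟨N.toSeminorm y, ?_, fun x => ?_⟩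
    · exact lt_of_le_of_ne (apply_nonneg _ _) fun h0 => hy0 (N.eq_zero_of_map_eq_zero y h0.symm)
    · by_cases hx : x = 0
      · simp [hx]
      · have hs : ‖x‖⁻¹ • x ∈ Metric.sphere (0 : EuclideanSpace ℝ (Fin d)) 1 := by
          simp [norm_smul, hx]
        have h1 : N.toSeminorm y ≤ N.toSeminorm (‖x‖⁻¹ • x) := hmin hs
        rw [map_smul_eq_mul, norm_inv, norm_norm, inv_mul_eq_div,
          le_div_iff₀ (norm_pos_iff.2 hx)] at h1
        exact h1

/-- The unit ball `{x | N x ≤ 1}` of a norm `N` on `ℝ^d`, as a symmetric convex body. -/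
def unitBall (N : DNorm d) : SymmetricBody d :=
  ⟨{ carrier := {x | N.toSeminorm x ≤ 1}
     convex' := by simpa [Seminorm.closedBall_zero_eq] using N.toSeminorm.convex_closedBall 0 1
     isCompact' := by
       obtain ⟨c, hc, h⟩ := N.exists_pos_mul_norm_le
       refine (isCompact_closedBall (0 : EuclideanSpace ℝ (Fin d)) c⁻¹).of_isClosed_subset
         (isClosed_le N.continuous continuous_const) fun x hx => ?_
       rw [mem_closedBall_zero_iff, ← one_div, le_div_iff₀ hc, mul_comm]
       exact (h x).trans hx
     nonempty' := ⟨0, by simp⟩ },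
    fun x (hx : N.toSeminorm x ≤ 1) => show N.toSeminorm (-x) ≤ 1 by rwa [map_neg_eq_map],
    mem_interior.2 ⟨{x | N.toSeminorm x < 1}, fun x (hx : N.toSeminorm x < 1) => show N.toSeminorm x ≤ 1 from hx.le,
      isOpen_lt N.continuous continuous_const, by simp⟩⟩

/-- The unit distance graph of a norm `N` on `ℝ^d`: two points are adjacent iff their distance
according to `N` is one. -/
def unitDistanceGraph (N : DNorm d) : SimpleGraph (EuclideanSpace ℝ (Fin d)) where
  Adj x y := N.toSeminorm (x - y) = 1
  symm := ⟨fun x y h => by rw [← h, map_sub_rev]⟩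
  loopless := ⟨fun x h => by simp at h⟩

/-- The number of unit distances according to `N` among the points of the finite set `P`, that is,
the number of unordered pairs of points of `P` at distance one. -/
noncomputable def numUnitDistances (N : DNorm d) (P : Finset (EuclideanSpace ℝ (Fin d))) : ℕ :=
  (N.unitDistanceGraph.induce (P : Set (EuclideanSpace ℝ (Fin d)))).edgeSet.ncard

end DNorm

/-! For a generic norm the unit vectors satisfy few rational relations: finitely many of them, no
two opposite, number at most `d` times their rational rank (`card_le_mul_finrank_span`). Indeed `k`
vectors of rational rank `l` range over a real space of dimension at most `d * l`, and lying on the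
unit sphere imposes `k` conditions. If `k > d * l` the system is overdetermined, and a small
perturbation of the body destroys its well-separated solutions
(`exists_dist_lt_notMem_withBoundaryTuple`). Only countably many rational coefficient matrices
occur, so the exceptional bodies form a meagre set.

Given `P`, weight each unit difference, taken up to sign, by the number of pairs that realise it.
The rank bound and a greedy choice (`exists_linearIndepOn_sum_le`) yield a rationally independent
set carrying at least `1 / d` of the weight. Independent differences behave like the edge directions
of a grid, and halving arguments bound their number by `(n / 2) log₂ n`
(`two_mul_sum_translateCount_le`). -/

/-! ### Superadditivity of `t log₂ t` -/

/-- The gain is `a log₂ ((a + b) / a) + b log₂ ((a + b) / b)`. Each term is at least `a`: the first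
as `b ≥ a`, the second by Bernoulli's inequality `(1 + a / b) ^ (b / a) ≥ 2`. -/
theorem mul_log_add_mul_log_add_le {a b : ℝ} (ha : 0 < a) (hab : a ≤ b) :
    a * Real.logb 2 a + b * Real.logb 2 b + 2 * a ≤ (a + b) * Real.logb 2 (a + b) := by
  have hb : 0 < b := ha.trans_le hab
  have hlog2 : 0 < Real.log 2 := Real.log_pos one_lt_two
  have h1 : Real.log 2 ≤ Real.log (a + b) - Real.log a := by
    rw [← Real.log_div (by positivity) ha.ne']
    exact Real.log_le_log two_pos (by rw [le_div_iff₀ ha]; linarith)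
  have h2 : a * Real.log 2 ≤ b * (Real.log (a + b) - Real.log b) := by
    have hB : 1 + b / a * (a / b) ≤ (1 + a / b) ^ (b / a) :=
      one_add_mul_self_le_rpow_one_add (by have : 0 < a / b := by positivity
                                           linarith) (by rwa [one_le_div ha])
    have e : b / a * (a / b) = 1 := by field_simp
    rw [e, one_add_one_eq_two] at hB
    have h3 := Real.log_le_log two_pos hB
    rw [Real.log_rpow (by positivity)] at h3
    have e2 : 1 + a / b = (a + b) / b := by field_simp; ring
    rw [e2, Real.log_div (by positivity) hb.ne', div_mul_eq_mul_div, le_div_iff₀ ha] at h3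
    linarith
  simp only [Real.logb]
  have h4 : a * Real.log a + b * Real.log b + 2 * a * Real.log 2 ≤
      (a + b) * Real.log (a + b) := by nlinarith
  have : 2 * a = 2 * a * Real.log 2 / Real.log 2 := by field_simp
  rw [this, ← mul_div_assoc, ← mul_div_assoc, ← mul_div_assoc, ← add_div, ← add_div]
  gcongr

theorem mul_log_add_mul_log_add_min_le {a b : ℕ} (ha : 0 < a) (hb : 0 < b) :
    a * Real.logb 2 a + b * Real.logb 2 b + 2 * (min a b : ℕ) ≤
      ((a + b : ℕ) : ℝ) * Real.logb 2 (a + b : ℕ) := by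
  push_cast
  rcases le_total a b with h | h
  · have h' : (a : ℝ) ≤ b := by exact_mod_cast h
    rw [min_eq_left h']
    exact mul_log_add_mul_log_add_le (by exact_mod_cast ha) h'
  · have h' : (b : ℝ) ≤ a := by exact_mod_cast h
    rw [min_eq_right h', add_comm (a : ℝ) b]
    have := mul_log_add_mul_log_add_le (by exact_mod_cast hb) h'
    linarith

/-! ### Counting differences from a rationally independent set -/

section Translates

variable {V : Type*} [AddCommGroup V] [DecidableEq V]

/-- The number of points of `P` whose translate by `u` is also in `P`. -/
def translateCount (P : Finset V) (u : V) : ℕ := {x ∈ P | x + u ∈ P}.card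

theorem translateCount_eq_of_split (P : Finset V) (u : V) (p : V → Prop) [DecidablePred p]
    (hp : ∀ x, p (x + u) → p x) :
    translateCount P u = translateCount {x ∈ P | p x} u + translateCount {x ∈ P | ¬ p x} u +
      {x ∈ P | x + u ∈ P ∧ p x ∧ ¬ p (x + u)}.card := by
  unfold translateCount
  rw [← Finset.card_union_of_disjoint, ← Finset.card_union_of_disjoint]
  · congr 1
    ext x
    simp only [Finset.mem_filter, Finset.mem_union]
    have := hp x
    tauto
  · rw [Finset.disjoint_left]
    intro x
    simp only [Finset.mem_filter, Finset.mem_union]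
    tauto
  · rw [Finset.disjoint_left]
    intro x
    simp only [Finset.mem_filter]
    tauto

/-- Pairs cross the cut in one direction only, and each is determined by either of its endpoints. -/
theorem translateCount_split_le (P : Finset V) (u : V) (p : V → Prop) [DecidablePred p]
    (hp : ∀ x, p (x + u) → p x) :
    translateCount P u ≤ translateCount {x ∈ P | p x} u + translateCount {x ∈ P | ¬ p x} u +
      min {x ∈ P | p x}.card {x ∈ P | ¬ p x}.card := by
  rw [translateCount_eq_of_split P u p hp]
  refine Nat.add_le_add_left (le_min (Finset.card_le_card fun x => ?_) ?_) _
  · simp only [Finset.mem_filter]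
    tauto
  · refine Finset.card_le_card_of_injOn (· + u) (fun x => ?_) fun x _ y _ h => add_right_cancel h
    simp only [Finset.coe_filter, Set.mem_ofPred_eq]
    tauto

theorem translateCount_split_eq (P : Finset V) (u : V) (p : V → Prop) [DecidablePred p]
    (hp : ∀ x, p (x + u) ↔ p x) :
    translateCount P u = translateCount {x ∈ P | p x} u + translateCount {x ∈ P | ¬ p x} u := by
  rw [translateCount_eq_of_split P u p fun x => (hp x).1, Nat.add_eq_left, Finset.card_eq_zero,
    Finset.filter_eq_empty_iff]
  intro x _
  rw [hp]
  tauto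

/-- A set of `n` points spans at most `(n / 2) log₂ n` differences that belong to a given linearly
independent set. -/
theorem two_mul_sum_translateCount_le [Module ℚ V] (I : Finset V)
    (hI : LinearIndepOn ℚ id (I : Set V)) (P : Finset V) :
    2 * ((∑ u ∈ I, translateCount P u : ℕ) : ℝ) ≤ P.card * Real.logb 2 P.card := by
  induction P using Finset.strongInduction with
  | H P ih =>
  by_cases h0 : ∀ u ∈ I, translateCount P u = 0
  · rw [Finset.sum_eq_zero fun u hu => h0 u hu, Nat.cast_zero, mul_zero]
    rcases Nat.eq_zero_or_pos P.card with h | h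
    · simp [h]
    · exact mul_nonneg (Nat.cast_nonneg _) (Real.logb_nonneg one_lt_two (by exact_mod_cast h))
  push Not at h0
  obtain ⟨u, hu, hne⟩ := h0
  obtain ⟨x, hx⟩ := Finset.card_ne_zero.1 hne
  rw [Finset.mem_filter] at hx
  have hnot : u ∉ Submodule.span ℚ ((I : Set V) \ {u}) := by
    simpa using hI.notMem_span (i := u) (by exact_mod_cast hu)
  obtain ⟨g, hgu, hg⟩ := Submodule.exists_le_ker_of_notMem hnot
  set φ : V →ₗ[ℚ] ℚ := (g u)⁻¹ • g with hφ
  have hφu : φ u = 1 := by simp [hφ, hgu]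
  have hφw : ∀ w ∈ I, w ≠ u → φ w = 0 := fun w hw hwu => by
    have : g w = 0 := hg (Submodule.subset_span ⟨by exact_mod_cast hw, hwu⟩)
    simp [hφ, this]
  -- Cutting at the level `φ x` separates `x` from `x + u`, so both halves are nonempty.
  -- Translations by the other members of `I` preserve `φ`, so only pairs with difference `u` are
  -- cut.
  set p : V → Prop := fun y => φ y ≤ φ x with hp
  have hxA : x ∈ {y ∈ P | p y} := by simp [hx.1, hp]
  have hxB : x + u ∈ {y ∈ P | ¬ p y} := by simp [hx.2, hp, hφu]
  have hcard : {y ∈ P | p y}.card + {y ∈ P | ¬ p y}.card = P.card :=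
    Finset.card_filter_add_card_filter_not _
  have hA := ih {y ∈ P | p y} (Finset.filter_ssubset.2 ⟨x + u, hx.2, (Finset.mem_filter.1 hxB).2⟩)
  have hB := ih {y ∈ P | ¬ p y}
    (Finset.filter_ssubset.2 ⟨x, hx.1, not_not.2 (Finset.mem_filter.1 hxA).2⟩)
  have hsum : ∑ w ∈ I, translateCount P w ≤ ∑ w ∈ I, translateCount {y ∈ P | p y} w +
      ∑ w ∈ I, translateCount {y ∈ P | ¬ p y} w +
      min {y ∈ P | p y}.card {y ∈ P | ¬ p y}.card := by
    rw [← Finset.add_sum_erase I _ hu, ← Finset.add_sum_erase I _ hu, ← Finset.add_sum_erase I _ hu]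
    have h1 := translateCount_split_le P u p fun y => by simp only [hp, map_add, hφu]; intro; linarith
    have h2 : ∑ w ∈ I.erase u, translateCount P w =
        ∑ w ∈ I.erase u, translateCount {y ∈ P | p y} w +
        ∑ w ∈ I.erase u, translateCount {y ∈ P | ¬ p y} w := by
      rw [← Finset.sum_add_distrib]
      refine Finset.sum_congr rfl fun w hw => ?_
      rw [Finset.mem_erase] at hw
      exact translateCount_split_eq P w p fun y => by simp [hp, hφw w hw.2 hw.1]
    omega
  have hlog := mul_log_add_mul_log_add_min_le (Finset.card_pos.2 ⟨x, hxA⟩)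
    (Finset.card_pos.2 ⟨x + u, hxB⟩)
  rw [hcard] at hlog
  have hsum' : ((∑ w ∈ I, translateCount P w : ℕ) : ℝ) ≤
      (∑ w ∈ I, translateCount {y ∈ P | p y} w : ℕ) +
      (∑ w ∈ I, translateCount {y ∈ P | ¬ p y} w : ℕ) +
      (min {y ∈ P | p y}.card {y ∈ P | ¬ p y}.card : ℕ) := by exact_mod_cast hsum
  linarith

/-- If every subset of `S` has at most `d` times as many elements as its rank, then a heaviest
linearly independent subset of `S` carries at least the fraction `1 / d` of the weight of `S`. -/
theorem exists_linearIndepOn_sum_le [Module ℚ V] (d : ℕ) (e : V → ℕ) (S : Finset V)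
    (hS : ∀ T ⊆ S, T.card ≤ d * Module.finrank ℚ (Submodule.span ℚ (T : Set V))) :
    ∃ I ⊆ S, LinearIndepOn ℚ id (I : Set V) ∧ ∑ u ∈ S, e u ≤ d * ∑ u ∈ I, e u := by
  -- Greedy choice by decreasing weight. Lowering all weights by `m` allows the induction to be used
  -- at `m = e a`, where the new element `a` weighs nothing; going back to `m` adds a constant per
  -- element, which the rank bound controls.
  suffices h : ∃ I ⊆ S, LinearIndepOn ℚ id (I : Set V) ∧
      (S : Set V) ⊆ Submodule.span ℚ (I : Set V) ∧
      ∀ m : ℕ, (∀ u ∈ S, m ≤ e u) →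
        ∑ u ∈ S, ((e u : ℤ) - m) ≤ d * ∑ u ∈ I, ((e u : ℤ) - m) by
    obtain ⟨I, hIS, hI, -, h⟩ := h
    refine ⟨I, hIS, hI, ?_⟩
    have := h 0 fun _ _ => Nat.zero_le _
    simp only [Nat.cast_zero, sub_zero] at this
    exact_mod_cast this
  induction S using Finset.induction_on_min_value e with
  | empty => exact ⟨∅, by simp⟩
  | insert a S haS hmin ih =>
    obtain ⟨I, hIS, hI, hspan, hsum⟩ := ih fun T hT => hS T (hT.trans (Finset.subset_insert _ _))
    obtain ⟨J, hJS, hJ, hspanJ, hJsum⟩ : ∃ J ⊆ insert a S, LinearIndepOn ℚ id (J : Set V) ∧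
        ((insert a S : Finset V) : Set V) ⊆ Submodule.span ℚ (J : Set V) ∧
        ∑ u ∈ J, ((e u : ℤ) - e a) = ∑ u ∈ I, ((e u : ℤ) - e a) := by
      by_cases ha : a ∈ Submodule.span ℚ (I : Set V)
      · refine ⟨I, hIS.trans (Finset.subset_insert _ _), hI, ?_, rfl⟩
        rw [Finset.coe_insert]
        exact Set.insert_subset ha hspan
      · have haI : a ∉ I := fun h => ha (Submodule.subset_span h)
        refine ⟨insert a I, Finset.insert_subset_insert _ hIS, ?_, ?_, ?_⟩
        · rw [Finset.coe_insert]
          exact hI.id_insert ha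
        · rw [Finset.coe_insert, Finset.coe_insert]
          exact Set.insert_subset (Submodule.subset_span (Set.mem_insert _ _))
            (hspan.trans (Submodule.span_mono (Set.subset_insert _ _)))
        · rw [Finset.sum_insert haI, sub_self, zero_add]
    refine ⟨J, hJS, hJ, hspanJ, fun m hm => ?_⟩
    have hcard : (insert a S).card ≤ d * J.card := by
      refine (hS _ subset_rfl).trans (Nat.mul_le_mul_left d ?_)
      calc Module.finrank ℚ (Submodule.span ℚ ((insert a S : Finset V) : Set V))
          ≤ Module.finrank ℚ (Submodule.span ℚ (J : Set V)) :=
            Submodule.finrank_mono (Submodule.span_le.2 hspanJ)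
        _ ≤ J.card := finrank_span_finset_le_card J
    have key : ∀ T : Finset V, ∑ u ∈ T, ((e u : ℤ) - m) =
        ∑ u ∈ T, ((e u : ℤ) - e a) + T.card * ((e a : ℤ) - m) := fun T => by
      rw [← nsmul_eq_mul, ← Finset.sum_const, ← Finset.sum_add_distrib]
      exact Finset.sum_congr rfl fun _ _ => by ring
    rw [key, key, Finset.sum_insert haS, sub_self, zero_add, hJsum, mul_add, ← mul_assoc]
    have h1 : (0 : ℤ) ≤ e a - m := by
      have := hm a (Finset.mem_insert_self _ _)
      omega
    have h2 : ((insert a S).card : ℤ) ≤ d * J.card := by exact_mod_cast hcard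
    exact add_le_add (hsum (e a) hmin) (mul_le_mul_of_nonneg_right h2 h1)

end Translates

/-! ### Strictly convex approximation, polytopes and generic facets -/

section Approximation

variable {E : Type*} [NormedAddCommGroup E] [InnerProductSpace ℝ E]

/-- The sum, in the `ℓ²` sense, of a seminorm and a multiple of the Euclidean norm. -/
noncomputable def Seminorm.addNormSq (N : Seminorm ℝ E) (s : ℝ) (x : E) : ℝ :=
  √(N x ^ 2 + s * ‖x‖ ^ 2)

namespace Seminorm

variable (N : Seminorm ℝ E) {s : ℝ}

theorem addNormSq_nonneg (x : E) : 0 ≤ N.addNormSq s x := Real.sqrt_nonneg _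

theorem sq_addNormSq (hs : 0 ≤ s) (x : E) : N.addNormSq s x ^ 2 = N x ^ 2 + s * ‖x‖ ^ 2 :=
  Real.sq_sqrt (by positivity)

theorem le_addNormSq (hs : 0 ≤ s) (x : E) : N x ≤ N.addNormSq s x :=
  Real.le_sqrt_of_sq_le (le_add_of_nonneg_right (by positivity))

theorem addNormSq_smul (c : ℝ) (x : E) : N.addNormSq s (c • x) = |c| * N.addNormSq s x := by
  unfold addNormSq
  rw [map_smul_eq_mul, norm_smul, Real.norm_eq_abs, ← Real.sqrt_sq (abs_nonneg c),
    ← Real.sqrt_mul (sq_nonneg _), Real.sqrt_sq (abs_nonneg c)]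
  ring_nf

theorem addNormSq_neg (x : E) : N.addNormSq s (-x) = N.addNormSq s x := by
  simpa using N.addNormSq_smul (s := s) (-1) x

theorem addNormSq_pos (hs : 0 < s) {x : E} (hx : x ≠ 0) : 0 < N.addNormSq s x := by
  have := norm_pos_iff.2 hx
  exact Real.sqrt_pos.2 (by positivity)

theorem addNormSq_add_le (hs : 0 ≤ s) (x y : E) :
    N.addNormSq s (x + y) ≤ N.addNormSq s x + N.addNormSq s y := by
  have hx := N.addNormSq_nonneg (s := s) x
  have hy := N.addNormSq_nonneg (s := s) y
  refine Real.sqrt_le_iff.2 ⟨add_nonneg hx hy, ?_⟩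
  have h1 : N (x + y) ^ 2 ≤ (N x + N y) ^ 2 :=
    pow_le_pow_left₀ (apply_nonneg _ _) (map_add_le_add _ _ _) 2
  have h2 : ‖x + y‖ ^ 2 ≤ (‖x‖ + ‖y‖) ^ 2 :=
    pow_le_pow_left₀ (norm_nonneg _) (norm_add_le _ _) 2
  have h3 : N x * N y + s * (‖x‖ * ‖y‖) ≤ N.addNormSq s x * N.addNormSq s y := by
    refine abs_le_of_sq_le_sq' ?_ (mul_nonneg hx hy) |>.2
    rw [mul_pow, N.sq_addNormSq hs, N.sq_addNormSq hs]
    nlinarith [mul_nonneg hs (sq_nonneg (N x * ‖y‖ - N y * ‖x‖))]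
  have h4 := mul_le_mul_of_nonneg_left h2 hs
  nlinarith [N.sq_addNormSq hs x, N.sq_addNormSq hs y]

theorem continuous_addNormSq (hN : Continuous N) : Continuous (N.addNormSq s) := by
  unfold addNormSq
  fun_prop

/-- The slices of the ball of radius `m` that a supporting hyperplane of the unit ball cuts off are
small if `m` is close to `1`. -/
theorem mul_norm_sub_sq_le_of_support (hs : 0 ≤ s) {f : E →ₗ[ℝ] ℝ} (hf : ∀ y, f y ≤ N.addNormSq s y)
    {m : ℝ} {u v : E} (hu : 1 ≤ f u) (hv : 1 ≤ f v) (hu' : N.addNormSq s u ≤ m)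
    (hv' : N.addNormSq s v ≤ m) : s * ‖u - v‖ ^ 2 ≤ 4 * (m ^ 2 - 1) := by
  -- The support functional forces `u + v` to be long, while the parallelogram law for the Euclidean
  -- part makes it short unless `u - v` is small.
  have h1 : 2 ≤ N.addNormSq s (u + v) := by
    have := hf (u + v)
    rw [map_add] at this
    linarith
  have h2 : 4 ≤ N (u + v) ^ 2 + s * ‖u + v‖ ^ 2 := by
    rw [← N.sq_addNormSq hs]
    nlinarith
  have h3 : N (u + v) ^ 2 ≤ (N u + N v) ^ 2 :=
    pow_le_pow_left₀ (apply_nonneg _ _) (map_add_le_add _ _ _) 2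
  have h4 : ‖u + v‖ ^ 2 = 2 * ‖u‖ ^ 2 + 2 * ‖v‖ ^ 2 - ‖u - v‖ ^ 2 := by
    have := parallelogram_law_with_norm ℝ u v
    nlinarith
  have h5 := pow_le_pow_left₀ (N.addNormSq_nonneg u) hu' 2
  have h6 := pow_le_pow_left₀ (N.addNormSq_nonneg v) hv' 2
  rw [N.sq_addNormSq hs] at h5 h6
  rw [h4] at h2
  nlinarith [sq_nonneg (N u - N v)]

theorem exists_support_addNormSq (hs : 0 ≤ s) (x : E) :
    ∃ f : E →ₗ[ℝ] ℝ, (∀ y, f y ≤ N.addNormSq s y) ∧ f x = N.addNormSq s x := by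
  by_cases hx : x = 0
  · refine ⟨0, fun y => N.addNormSq_nonneg y, ?_⟩
    simp [hx, addNormSq]
  · obtain ⟨g, hg, hg'⟩ := exists_extension_of_le_sublinear
      (LinearPMap.mkSpanSingleton (K := ℝ) x (N.addNormSq s x) hx) (N.addNormSq s)
      (fun c hc y => by rw [N.addNormSq_smul, abs_of_pos hc]) (N.addNormSq_add_le hs) (by
        rintro ⟨y, hy⟩
        obtain ⟨c, rfl⟩ := Submodule.mem_span_singleton.1 hy
        rw [LinearPMap.mkSpanSingleton'_apply, N.addNormSq_smul, RingHom.id_apply, smul_eq_mul]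
        exact mul_le_mul_of_nonneg_right (le_abs_self c) (N.addNormSq_nonneg x))
    refine ⟨g, hg', ?_⟩
    have := hg ⟨x, Submodule.mem_span_singleton_self x⟩
    rw [LinearPMap.mkSpanSingleton_apply] at this
    exact this

/-- By compactness of the sphere, finitely many supporting half-spaces enclose the unit ball up to
the factor `1 + δ`. -/
theorem exists_finset_support_addNormSq [FiniteDimensional ℝ E] (hN : Continuous N) (hs : 0 < s)
    {δ : ℝ} (hδ : 0 < δ) :
    ∃ t : Finset (E →ₗ[ℝ] ℝ), (∀ f ∈ t, ∀ y, f y ≤ N.addNormSq s y) ∧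
      ∀ y, y ≠ 0 → ∃ f ∈ t, N.addNormSq s y < (1 + δ) * f y := by
  classical
  choose f hf hfx using N.exists_support_addNormSq (s := s) hs.le
  obtain ⟨t, -, ht⟩ := (isCompact_sphere (0 : E) 1).elim_nhds_subcover
    (fun x => {y | N.addNormSq s y < (1 + δ) * f x y}) fun x hx => by
      refine (isOpen_lt (N.continuous_addNormSq hN)
        (continuous_const.mul (f x).continuous_of_finiteDimensional)).mem_nhds ?_
      change N.addNormSq s x < (1 + δ) * f x x
      rw [hfx]
      have := N.addNormSq_pos hs (x := x) (by rintro rfl; simp at hx)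
      nlinarith
  refine ⟨t.image f, ?_, fun y hy => ?_⟩
  · simp only [Finset.mem_image]
    rintro _ ⟨x, -, rfl⟩
    exact hf x
  · have hy' : 0 < ‖y‖ := norm_pos_iff.2 hy
    have hs' : ‖y‖⁻¹ • y ∈ Metric.sphere (0 : E) 1 := by simp [norm_smul, hy]
    obtain ⟨x, hx, hxy⟩ := Set.mem_iUnion₂.1 (ht hs')
    refine ⟨f x, Finset.mem_image_of_mem f hx, ?_⟩
    change N.addNormSq s (‖y‖⁻¹ • y) < (1 + δ) * f x (‖y‖⁻¹ • y) at hxy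
    rw [N.addNormSq_smul, abs_of_pos (inv_pos.2 hy'), map_smul, smul_eq_mul, mul_left_comm] at hxy
    exact lt_of_mul_lt_mul_left hxy (inv_pos.2 hy').le

end Seminorm

/-- Finitely many hyperplanes are null sets and cannot cover an open box. -/
theorem exists_mem_Ioo_forall_apply_ne_zero {ι α : Type*} [Fintype ι] [Finite α]
    (c : α → (ι → ℝ) →ₗ[ℝ] ℝ) (hc : ∀ a, c a ≠ 0) {δ : ℝ} (hδ : 0 < δ) :
    ∃ β : ι → ℝ, (∀ i, 1 < β i ∧ β i < 1 + δ) ∧ ∀ a, c a β ≠ 0 := by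
  by_contra! h
  have hsub : (Set.pi Set.univ fun _ : ι => Set.Ioo (1 : ℝ) (1 + δ)) ⊆
      ⋃ a, ((c a).ker : Set (ι → ℝ)) := fun β hβ => by
    obtain ⟨a, ha⟩ := h β fun i => hβ i trivial
    exact Set.mem_iUnion.2 ⟨a, ha⟩
  have hpos : 0 < MeasureTheory.volume (Set.pi Set.univ fun _ : ι => Set.Ioo (1 : ℝ) (1 + δ)) :=
    (isOpen_set_pi Set.finite_univ fun _ _ => isOpen_Ioo).measure_pos _
      ⟨fun _ => 1 + δ / 2, fun _ _ => ⟨by linarith, by linarith⟩⟩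
  have hzero : MeasureTheory.volume (⋃ a, ((c a).ker : Set (ι → ℝ))) = 0 :=
    MeasureTheory.measure_iUnion_null fun a =>
      MeasureTheory.Measure.addHaar_submodule _ _ (by rw [Ne, LinearMap.ker_eq_top]; exact hc a)
  exact (hpos.trans_le (MeasureTheory.measure_mono hsub)).ne' hzero

/-- Generic right-hand sides `β` make all the overdetermined systems `f (i r) (u r) = ± β (i r)`
unsolvable in a space `W` of smaller dimension than the number of equations. -/
theorem exists_generic_rhs {κ : Type*} [Fintype κ] [FiniteDimensional ℝ E]
    (W : Submodule ℝ (κ → E)) (hW : Module.finrank ℝ W < Fintype.card κ)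
    {ι : Type*} [Fintype ι] (f : ι → E →ₗ[ℝ] ℝ) {δ : ℝ} (hδ : 0 < δ) :
    ∃ β : ι → ℝ, (∀ i, 1 < β i ∧ β i < 1 + δ) ∧
      ∀ (i : κ → ι) (σ : κ → ℤˣ), Function.Injective i →
        ∀ u ∈ W, ¬ ∀ r, f (i r) (u r) = ((σ r : ℤ) : ℝ) * β (i r) := by
  classical
  -- For fixed `i` and `σ`, a solvable `β` is mapped by `D` into the proper subspace `L(W)`. As `D`
  -- is onto by injectivity of `i`, such `β` lie in a hyperplane.
  have key : ∀ a : {i : κ → ι // Function.Injective i} × (κ → ℤˣ), ∃ c : (ι → ℝ) →ₗ[ℝ] ℝ,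
      c ≠ 0 ∧ ∀ β, ∀ u ∈ W, (∀ r, f (a.1.1 r) (u r) = ((a.2 r : ℤ) : ℝ) * β (a.1.1 r)) →
        c β = 0 := by
    rintro ⟨⟨i, hi⟩, σ⟩
    let L : (κ → E) →ₗ[ℝ] (κ → ℝ) := LinearMap.pi fun r => f (i r) ∘ₗ LinearMap.proj r
    let D : (ι → ℝ) →ₗ[ℝ] (κ → ℝ) :=
      LinearMap.pi fun r => (((σ r : ℤ) : ℝ)) • LinearMap.proj (i r)
    have hD : Function.Surjective D := fun z => by
      refine ⟨Function.extend i (fun r => ((σ r : ℤ) : ℝ) * z r) 0, funext fun r => ?_⟩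
      have : ((σ r : ℤ) : ℝ) * ((σ r : ℤ) : ℝ) = 1 := by
        rw [← Int.cast_mul, ← Units.val_mul, Int.units_mul_self]
        simp
      simp [D, hi.extend_apply, ← mul_assoc, this]
    have hlt : W.map L < ⊤ := by
      refine lt_top_iff_ne_top.2 fun h => ?_
      have h1 := Submodule.finrank_map_le L W
      rw [h, finrank_top, Module.finrank_fintype_fun_eq_card] at h1
      omega
    obtain ⟨g, hg0, hg⟩ := Submodule.exists_le_ker_of_lt_top _ hlt
    refine ⟨g ∘ₗ D, fun h => hg0 ?_, fun β u hu hβ => ?_⟩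
    · refine LinearMap.ext fun z => ?_
      obtain ⟨β, rfl⟩ := hD z
      exact LinearMap.congr_fun h β
    · have : D β = L u := funext fun r => by simp [D, L, hβ r]
      rw [LinearMap.comp_apply, this]
      exact hg (Submodule.mem_map_of_mem hu)
  choose c hc0 hc using key
  obtain ⟨β, hβ, hβc⟩ := exists_mem_Ioo_forall_apply_ne_zero c hc0 hδ
  exact ⟨β, hβ, fun i σ hi u hu h => hβc ⟨⟨i, hi⟩, σ⟩ (hc ⟨⟨i, hi⟩, σ⟩ β u hu h)⟩

end Approximation

/-! ### Hausdorff distance of convex bodies -/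

section Bodies

variable {E : Type*} [NormedAddCommGroup E] [InnerProductSpace ℝ E]

/-- A point whose distance to the boundary of a convex set exceeds its Hausdorff distance to a
convex body is an interior point of the body. -/
theorem ConvexBody.mem_interior_of_ball_subset [CompleteSpace E] {K L : ConvexBody E}
    (hL : (interior (L : Set E)).Nonempty) {x : E} {r : ℝ} (hx : Metric.ball x r ⊆ K)
    (hKL : dist K L < r) : x ∈ interior (L : Set E) := by
  by_contra hxL
  obtain ⟨f, hf⟩ := geometric_hahn_banach_open_point L.convex.interior isOpen_interior hxL
  have hfL : ∀ z ∈ L, f z ≤ f x := fun z hz => by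
    have hz' : z ∈ closure (interior (L : Set E)) := by
      rw [L.convex.closure_interior_eq_closure_of_nonempty_interior hL]
      exact subset_closure hz
    exact closure_minimal (fun y hy => (hf y hy).le)
      (isClosed_le f.continuous continuous_const) hz'
  -- Moving from `x` by `r'` along the outer normal `a` stays in `K` but reaches distance at least
  -- `r'` from `L`.
  obtain ⟨r', hr', hr'r⟩ := exists_between hKL
  have hr'0 : 0 < r' := dist_nonneg.trans_lt hr'
  set a := (InnerProductSpace.toDual ℝ E).symm f with ha
  have hfa : ∀ y, f y = inner ℝ a y := fun y => by rw [ha, InnerProductSpace.toDual_symm_apply]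
  have ha0 : a ≠ 0 := by
    rintro h0
    obtain ⟨y, hy⟩ := hL
    have := hf y hy
    simp [hfa, h0] at this
  have ha0' : 0 < ‖a‖ := norm_pos_iff.2 ha0
  have hy : x + (r' / ‖a‖) • a ∈ K := hx (by
    rw [mem_ball_iff_norm, add_sub_cancel_left, norm_smul, Real.norm_of_nonneg (by positivity),
      div_mul_cancel₀ _ ha0'.ne']
    exact hr'r)
  obtain ⟨z, hz, hyz⟩ := Metric.exists_dist_lt_of_hausdorffDist_lt hy
    (by rwa [ConvexBody.hausdorffDist_coe]) ConvexBody.hausdorffEDist_ne_top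
  have h1 : f (x + (r' / ‖a‖) • a) = f x + r' * ‖a‖ := by
    rw [map_add, map_smul, hfa a, real_inner_self_eq_norm_sq, smul_eq_mul]
    field_simp
  have h2 : f (x + (r' / ‖a‖) • a) - f z ≤ ‖a‖ * dist (x + (r' / ‖a‖) • a) z := by
    rw [← map_sub, hfa, dist_eq_norm]
    exact real_inner_le_norm _ _
  have h3 := hfL z hz
  have h4 := mul_lt_mul_of_pos_left hyz ha0'
  nlinarith

theorem ConvexBody.dist_le_of_smul_mem {K L : ConvexBody E} {τ R : ℝ} (hτ : 0 < τ) (hR : 0 ≤ R)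
    (hKR : ∀ x ∈ K, ‖x‖ ≤ R) (hKL : ∀ x ∈ K, (1 + τ)⁻¹ • x ∈ L) (hLK : ∀ x ∈ L, (1 + τ)⁻¹ • x ∈ K) :
    dist K L ≤ τ * R := by
  have h1 : (0 : ℝ) < 1 + τ := by linarith
  have key : ∀ x : E, dist x ((1 + τ)⁻¹ • x) = τ * ‖(1 + τ)⁻¹ • x‖ := fun x => by
    have : x - (1 + τ)⁻¹ • x = τ • ((1 + τ)⁻¹ • x) := by
      rw [smul_smul]
      nth_rw 1 [← one_smul ℝ x]
      rw [← sub_smul]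
      congr 1
      field_simp
      ring
    rw [dist_eq_norm, this, norm_smul, Real.norm_of_nonneg hτ.le]
  rw [← ConvexBody.hausdorffDist_coe]
  refine Metric.hausdorffDist_le_of_mem_dist (by positivity) (fun x hx => ⟨_, hKL x hx, ?_⟩)
    fun x hx => ⟨_, hLK x hx, ?_⟩
  · rw [key]
    refine mul_le_mul_of_nonneg_left ?_ hτ.le
    rw [norm_smul, Real.norm_of_nonneg (by positivity)]
    exact (mul_le_of_le_one_left (norm_nonneg _) (inv_le_one_of_one_le₀ (by linarith))).trans
      (hKR x hx)
  · rw [key]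
    exact mul_le_mul_of_nonneg_left (hKR _ (hLK x hx)) hτ.le

end Bodies

/-! ### Bodies with a separated boundary tuple are nowhere dense -/

namespace SymmetricBody

variable {d : ℕ} {κ : Type*}

/-- The symmetric bodies that have a `κ`-tuple of boundary points in `W` whose members are, even up
to sign, at distance at least `η` from each other. -/
def withBoundaryTuple (W : Submodule ℝ (κ → EuclideanSpace ℝ (Fin d))) (η : ℝ) :
    Set (SymmetricBody d) :=
  {K | ∃ u ∈ W, (∀ r, u r ∈ K.1 ∧ u r ∉ interior (K.1 : Set (EuclideanSpace ℝ (Fin d)))) ∧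
    ∀ r s, r ≠ s → η ≤ ‖u r - u s‖ ∧ η ≤ ‖u r + u s‖}

-- Bounded tuples subconverge. A fixed `η` keeps the limit points separated, and a limit point
-- interior to the limit body would make nearby tuple members interior to nearby bodies.
open Filter Topology in
theorem isClosed_withBoundaryTuple [Fintype κ] (W : Submodule ℝ (κ → EuclideanSpace ℝ (Fin d)))
    (η : ℝ) : IsClosed (withBoundaryTuple W η) := by
  refine IsSeqClosed.isClosed fun K L hK hKL => ?_
  choose u huW hu hsep using hK
  have hdist : Tendsto (fun n => dist (K n).1 L.1) atTop (𝓝 0) :=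
    tendsto_iff_dist_tendsto_zero.1 (continuous_subtype_val.continuousAt.tendsto.comp hKL)
  obtain ⟨R, hR⟩ := L.1.isBounded.exists_norm_le
  have hbdd : ∀ᶠ n in atTop, u n ∈ Metric.closedBall (0 : κ → EuclideanSpace ℝ (Fin d)) (R + 1) := by
    filter_upwards [hdist.eventually_lt_const one_pos] with n hn
    have hR0 : 0 ≤ R := (norm_nonneg _).trans (hR 0 (interior_subset L.2.2))
    rw [mem_closedBall_zero_iff, pi_norm_le_iff_of_nonneg (by linarith)]
    intro r
    obtain ⟨y, hy, hxy⟩ := Metric.exists_dist_lt_of_hausdorffDist_lt (hu n r).1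
      (by rwa [ConvexBody.hausdorffDist_coe]) ConvexBody.hausdorffEDist_ne_top
    have := norm_le_norm_add_norm_sub' (u n r) y
    rw [← dist_eq_norm] at this
    linarith [hR y hy]
  obtain ⟨v, -, φ, hφ, hv⟩ := tendsto_subseq_of_frequently_bounded
    Metric.isBounded_closedBall hbdd.frequently
  have hvr : ∀ r, Tendsto (fun n => u (φ n) r) atTop (𝓝 (v r)) := fun r =>
    (continuous_apply r).continuousAt.tendsto.comp hv
  have hdist' := hdist.comp hφ.tendsto_atTop
  refine ⟨v, W.closed_of_finiteDimensional.mem_of_tendsto hv (Eventually.of_forall fun n => huW _),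
    fun r => ⟨?_, fun hint => ?_⟩, fun r s hrs => ⟨?_, ?_⟩⟩
  · change v r ∈ (L.1 : Set (EuclideanSpace ℝ (Fin d)))
    rw [← L.1.isClosed.closure_eq, Metric.mem_closure_iff]
    intro ε hε
    obtain ⟨n, hn1, hn2⟩ := ((hdist'.eventually_lt_const (half_pos hε)).and
      ((tendsto_iff_dist_tendsto_zero.1 (hvr r)).eventually_lt_const (half_pos hε))).exists
    obtain ⟨y, hy, hxy⟩ := Metric.exists_dist_lt_of_hausdorffDist_lt (hu (φ n) r).1
      (by rw [ConvexBody.hausdorffDist_coe]; exact hn1) ConvexBody.hausdorffEDist_ne_top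
    refine ⟨y, hy, ?_⟩
    have := dist_triangle_left (v r) y (u (φ n) r)
    linarith
  · obtain ⟨ρ, hρ, hball⟩ := Metric.isOpen_iff.1 isOpen_interior _ hint
    obtain ⟨n, hn1, hn2⟩ := ((hdist'.eventually_lt_const (half_pos hρ)).and
      ((tendsto_iff_dist_tendsto_zero.1 (hvr r)).eventually_lt_const (half_pos hρ))).exists
    refine (hu (φ n) r).2 (ConvexBody.mem_interior_of_ball_subset (K := L.1) ⟨0, (K (φ n)).2.2⟩
      (r := ρ / 2) ?_ (by rw [dist_comm]; exact hn1))
    refine (Metric.ball_subset_ball' ?_).trans (hball.trans interior_subset)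
    linarith
  · exact ge_of_tendsto ((hvr r).sub (hvr s)).norm
      (Eventually.of_forall fun n => (hsep (φ n) r s hrs).1)
  · exact ge_of_tendsto ((hvr r).add (hvr s)).norm
      (Eventually.of_forall fun n => (hsep (φ n) r s hrs).2)

/-- The gauge of a symmetric body, as a seminorm. -/
noncomputable def gaugeSeminorm (K : SymmetricBody d) : Seminorm ℝ (EuclideanSpace ℝ (Fin d)) :=
  _root_.gaugeSeminorm (s := (K.1 : Set (EuclideanSpace ℝ (Fin d))))
    ((balanced_iff_neg_mem K.1.convex).2 fun x hx => K.2.1 x hx) K.1.convex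
    (absorbent_nhds_zero (mem_interior_iff_mem_nhds.1 K.2.2))

theorem continuous_gaugeSeminorm (K : SymmetricBody d) : Continuous K.gaugeSeminorm :=
  continuous_gauge K.1.convex (mem_interior_iff_mem_nhds.1 K.2.2)

theorem gaugeSeminorm_le_one_iff (K : SymmetricBody d) (x : EuclideanSpace ℝ (Fin d)) :
    K.gaugeSeminorm x ≤ 1 ↔ x ∈ K.1 := by
  have := gauge_le_one_iff_mem_closure (x := x) K.1.convex (mem_interior_iff_mem_nhds.1 K.2.2)
  rwa [K.1.isClosed.closure_eq] at this

/-- `K` is replaced by a symmetric polytope with facets too small to hold two members of a separated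
tuple, even up to sign. The members then satisfy equations of distinct facet pairs, which generic
offsets `β` make unsolvable in `W`. -/
theorem exists_dist_lt_notMem_withBoundaryTuple [Fintype κ]
    (W : Submodule ℝ (κ → EuclideanSpace ℝ (Fin d))) (hW : Module.finrank ℝ W < Fintype.card κ)
    {η : ℝ} (hη : 0 < η) (K : SymmetricBody d) {ε : ℝ} (hε : 0 < ε) :
    ∃ L : SymmetricBody d, dist K L < ε ∧ L ∉ withBoundaryTuple W η := by
  set N := K.gaugeSeminorm with hN
  obtain ⟨R, hR0, hR⟩ := K.1.isBounded.exists_pos_norm_le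
  obtain ⟨τ, hτ, hτR⟩ : ∃ τ : ℝ, 0 < τ ∧ τ * R < ε :=
    ⟨ε / (2 * R), by positivity, by field_simp; linarith⟩
  obtain ⟨s, hs, hsR⟩ : ∃ s : ℝ, 0 < s ∧ s * R ^ 2 = τ :=
    ⟨τ / R ^ 2, by positivity, by field_simp⟩
  obtain ⟨δ, hδ, hδτ, hδη⟩ : ∃ δ : ℝ, 0 < δ ∧ (1 + δ) ^ 2 ≤ 1 + τ ∧
      4 * (((1 + δ) ^ 2) ^ 2 - 1) < s * η ^ 2 := by
    have h0 : 0 < s * η ^ 2 := by positivity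
    -- For `δ < 1`, `(1 + δ) ^ 2 - 1 ≤ 3 * δ` and `4 * ((1 + δ) ^ 4 - 1) ≤ 60 * δ`.
    obtain ⟨δ, hδ, h⟩ := exists_between (lt_min one_pos (lt_min (div_pos hτ three_pos)
      (div_pos h0 (by norm_num : (0 : ℝ) < 60))))
    rw [lt_min_iff, lt_min_iff, lt_div_iff₀ three_pos, lt_div_iff₀ (by norm_num)] at h
    have h2 : δ ^ 2 ≤ δ := by nlinarith
    have h3 : δ ^ 3 ≤ δ := by nlinarith
    have h4 : δ ^ 4 ≤ δ := by nlinarith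
    exact ⟨δ, hδ, by nlinarith, by nlinarith⟩
  obtain ⟨t, ht, htN⟩ := N.exists_finset_support_addNormSq K.continuous_gaugeSeminorm hs hδ
  obtain ⟨β, hβ, hgen⟩ := exists_generic_rhs W hW (fun f : t => f.1) hδ
  have habs : ∀ f ∈ t, ∀ x, |f x| ≤ N.addNormSq s x := fun f hf x => by
    refine abs_le'.2 ⟨ht f hf x, ?_⟩
    rw [← map_neg, ← N.addNormSq_neg]
    exact ht f hf (-x)
  set C : Set (EuclideanSpace ℝ (Fin d)) := {x | ∀ f : t, |f.1 x| ≤ β f} with hC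
  -- One factor `1 + δ` comes from the finite family `t`, the other from the offsets `β`.
  have hCN : ∀ x ∈ C, N.addNormSq s x ≤ (1 + δ) ^ 2 := fun x hx => by
    by_cases hx0 : x = 0
    · rw [hx0, ← zero_smul ℝ (0 : EuclideanSpace ℝ (Fin d)), N.addNormSq_smul]
      simp only [abs_zero, zero_mul]
      positivity
    · obtain ⟨f, hf, hfx⟩ := htN x hx0
      have h1 := (le_abs_self _).trans (hx ⟨f, hf⟩)
      have h2 := (hβ ⟨f, hf⟩).2
      nlinarith
  have hτ1 : (0 : ℝ) < 1 + τ := by linarith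
  have hCK : ∀ x ∈ C, (1 + τ)⁻¹ • x ∈ K.1 := fun x hx => by
    rw [← gaugeSeminorm_le_one_iff, map_smul_eq_mul, Real.norm_of_nonneg (by positivity),
      inv_mul_le_one₀ hτ1]
    exact (N.le_addNormSq hs.le x).trans ((hCN x hx).trans hδτ)
  have hKC : ∀ x ∈ K.1, (1 + τ)⁻¹ • x ∈ C := fun x hx f => by
    rw [map_smul, smul_eq_mul, abs_mul, abs_of_pos (inv_pos.2 hτ1), inv_mul_le_iff₀ hτ1]
    have h1 : N.addNormSq s x ≤ 1 + τ := by
      refine Real.sqrt_le_iff.2 ⟨hτ1.le, ?_⟩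
      have h2 : N x ^ 2 ≤ 1 := pow_le_one₀ (apply_nonneg _ _) ((K.gaugeSeminorm_le_one_iff x).2 hx)
      have h3 : s * ‖x‖ ^ 2 ≤ s * R ^ 2 :=
        mul_le_mul_of_nonneg_left (pow_le_pow_left₀ (norm_nonneg _) (hR x hx) 2) hs.le
      nlinarith
    have h4 := (hβ f).1
    have h5 := habs f.1 f.2 x
    nlinarith
  have hfc : ∀ f : t, Continuous fun x => |f.1 x| := fun f =>
    continuous_abs.comp f.1.continuous_of_finiteDimensional
  have hopen : {x | ∀ f : t, |f.1 x| < β f} ⊆ interior C := by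
    refine interior_maximal (fun x hx f => (hx f).le) ?_
    simp only [Set.ofPred_forall]
    exact isOpen_iInter_of_finite fun f => isOpen_lt (hfc f) continuous_const
  have hclosed : IsClosed C := by
    simp only [hC, Set.ofPred_forall]
    exact isClosed_iInter fun f => isClosed_le (hfc f) continuous_const
  let L : SymmetricBody d :=
    ⟨{ carrier := C
       convex' := by
         simp only [hC, Set.ofPred_forall]
         refine convex_iInter fun f => ?_
         simp only [abs_le, Set.ofPred_and]
         exact (convex_halfSpace_ge f.1.isLinear _).inter (convex_halfSpace_le f.1.isLinear _)
       isCompact' := by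
         refine (isCompact_closedBall (0 : EuclideanSpace ℝ (Fin d)) ((1 + τ) * R)).of_isClosed_subset
           hclosed fun x hx => ?_
         have := hR _ (hCK x hx)
         rw [norm_smul, Real.norm_of_nonneg (by positivity), inv_mul_le_iff₀ hτ1] at this
         simpa using this
       nonempty' := ⟨0, fun f => by simpa using zero_le_one.trans (hβ f).1.le⟩ },
      fun x hx f => by simpa using hx f,
      hopen fun f => by simpa using zero_lt_one.trans (hβ f).1⟩
  refine ⟨L, (ConvexBody.dist_le_of_smul_mem hτ hR0.le hR hKC hCK).trans_lt hτR, ?_⟩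
  rintro ⟨u, huW, hu, hsep⟩
  have hface : ∀ r, ∃ (f : t) (σ : ℤˣ), f.1 (u r) = ((σ : ℤ) : ℝ) * β f := fun r => by
    by_contra! h
    refine (hu r).2 (hopen fun f => ?_)
    have hle : |f.1 (u r)| ≤ β f := (hu r).1 f
    refine lt_of_le_of_ne hle fun heq => ?_
    rcases abs_choice (f.1 (u r)) with h1 | h1
    · exact h f 1 (by simp [← heq, h1])
    · exact h f (-1) (by simp [← heq, h1])
  choose i σ hiσ using hface
  refine hgen i σ (fun r r' hrr' => ?_) u huW hiσ
  by_contra hne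
  -- A facet lies in a cap of the ball of radius `(1 + δ) ^ 2`, so the choice of `δ` makes its
  -- diameter less than `η`.
  have hsmall : ∀ x ∈ C, ∀ y ∈ C, (i r).1 x = β (i r) → (i r).1 y = β (i r) →
      ‖x - y‖ < η := fun x hx y hy hfx hfy => by
    have h1 := N.mul_norm_sub_sq_le_of_support hs.le (ht _ (i r).2) (by rw [hfx]; exact (hβ _).1.le)
      (by rw [hfy]; exact (hβ _).1.le) (hCN x hx) (hCN y hy)
    exact lt_of_pow_lt_pow_left₀ 2 hη.le (lt_of_mul_lt_mul_left (h1.trans_lt hδη) hs.le)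
  have hneg : ∀ x ∈ C, -x ∈ C := L.2.1
  have hr := hiσ r
  have hr' := hiσ r'
  rw [← hrr'] at hr'
  have hur : u r ∈ C := (hu r).1
  have hur' : u r' ∈ C := (hu r').1
  have hd := hsep r r' hne
  rcases Int.units_eq_one_or (σ r) with h1 | h1 <;> rcases Int.units_eq_one_or (σ r') with h2 | h2 <;>
    simp only [h1, h2, Units.val_one, Units.val_neg, Int.cast_one, Int.cast_neg, one_mul,
      neg_mul] at hr hr'
  · exact (hsmall _ hur _ hur' hr hr').not_ge hd.1
  · have := hsmall _ hur _ (hneg _ hur') hr (by rw [map_neg, hr', neg_neg])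
    rw [sub_neg_eq_add] at this
    exact this.not_ge hd.2
  · have := hsmall _ (hneg _ hur) _ hur' (by rw [map_neg, hr, neg_neg]) hr'
    rw [← neg_add', norm_neg] at this
    exact this.not_ge hd.2
  · have := hsmall _ (hneg _ hur) _ (hneg _ hur') (by rw [map_neg, hr, neg_neg])
      (by rw [map_neg, hr', neg_neg])
    rw [← neg_sub', norm_neg] at this
    exact this.not_ge hd.1

theorem isNowhereDense_withBoundaryTuple [Fintype κ]
    (W : Submodule ℝ (κ → EuclideanSpace ℝ (Fin d))) (hW : Module.finrank ℝ W < Fintype.card κ)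
    {η : ℝ} (hη : 0 < η) : IsNowhereDense (withBoundaryTuple W η) := by
  rw [(isClosed_withBoundaryTuple W η).isNowhereDense_iff, interior_eq_empty_iff_dense_compl,
    Metric.dense_iff]
  intro K ε hε
  obtain ⟨L, hL, hL'⟩ := exists_dist_lt_notMem_withBoundaryTuple W hW hη K hε
  exact ⟨L, by rwa [Metric.mem_ball, dist_comm], hL'⟩

end SymmetricBody

/-! ### The meagre set of exceptional bodies -/

/-- The tuples `(∑ j, A r j • v j)_r` of combinations of vectors `v j` with the rational
coefficients `A`. -/
def rationalTuples (d : ℕ) {k l : ℕ} (A : Matrix (Fin k) (Fin l) ℚ) :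
    Submodule ℝ (Fin k → EuclideanSpace ℝ (Fin d)) :=
  LinearMap.range (LinearMap.pi fun r => ∑ j, (A r j : ℝ) • LinearMap.proj j :
    (Fin l → EuclideanSpace ℝ (Fin d)) →ₗ[ℝ] (Fin k → EuclideanSpace ℝ (Fin d)))

theorem finrank_rationalTuples_le (d : ℕ) {k l : ℕ} (A : Matrix (Fin k) (Fin l) ℚ) :
    Module.finrank ℝ (rationalTuples d A) ≤ d * l := by
  refine (LinearMap.finrank_range_le _).trans_eq ?_
  rw [Module.finrank_pi_fintype]
  simp [mul_comm]

theorem mem_rationalTuples {d k l : ℕ} {A : Matrix (Fin k) (Fin l) ℚ}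
    {u : Fin k → EuclideanSpace ℝ (Fin d)} (v : Fin l → EuclideanSpace ℝ (Fin d))
    (h : ∀ r, u r = ∑ j, A r j • v j) : u ∈ rationalTuples d A :=
  ⟨v, funext fun r => by simp [h r, Rat.cast_smul_eq_qsmul]⟩

/-- The symmetric bodies that have, for some `k > d * l`, a `k`-tuple of boundary points, distinct
up to sign, that are rational combinations of `l` vectors. -/
def SymmetricBody.exceptional (d : ℕ) : Set (SymmetricBody d) :=
  ⋃ (k : ℕ) (l : ℕ) (A : Matrix (Fin k) (Fin l) ℚ) (_ : d * l < k) (m : ℕ),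
    SymmetricBody.withBoundaryTuple (rationalTuples d A) (1 / ((m : ℝ) + 1))

theorem SymmetricBody.isMeagre_exceptional (d : ℕ) : IsMeagre (SymmetricBody.exceptional d) := by
  refine isMeagre_iUnion fun k => isMeagre_iUnion fun l => ?_
  have : Countable (Matrix (Fin k) (Fin l) ℚ) := inferInstanceAs (Countable (Fin k → Fin l → ℚ))
  refine isMeagre_iUnion fun A => isMeagre_iUnion fun h => isMeagre_iUnion fun m => ?_
  refine (SymmetricBody.isNowhereDense_withBoundaryTuple _ ?_ (by positivity)).isMeagre
  rw [Fintype.card_fin]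
  exact (finrank_rationalTuples_le d A).trans_lt h

/-! ### Unit differences of a generic norm -/

namespace DNorm

variable {d : ℕ} (N : DNorm d)

theorem notMem_interior_unitBall {x : EuclideanSpace ℝ (Fin d)} (hx : N.toSeminorm x = 1) :
    x ∉ interior (N.unitBall.1 : Set (EuclideanSpace ℝ (Fin d))) := fun h => by
  have hc : Filter.Tendsto (fun t : ℝ => t • x) (nhds 1) (nhds x) := by
    have : Continuous fun t : ℝ => t • x := by fun_prop
    simpa using this.tendsto 1
  have h1 : ∀ᶠ t : ℝ in nhds 1, N.toSeminorm (t • x) ≤ 1 :=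
    hc.eventually (mem_interior_iff_mem_nhds.1 h)
  have h2 : ∀ᶠ t : ℝ in nhdsWithin 1 (Set.Ioi 1), 1 < t := self_mem_nhdsWithin
  obtain ⟨t, ht, ht'⟩ := (h2.and (h1.filter_mono nhdsWithin_le_nhds)).exists
  rw [map_smul_eq_mul, hx, mul_one, Real.norm_of_nonneg (by linarith)] at ht'
  linarith

/-- Coordinates of a violating `T` in a rational basis of its span form a matrix that witnesses that
the unit ball is exceptional; finiteness of `T` gives a uniform separation. -/
theorem card_le_mul_finrank_span (hN : N.unitBall ∉ SymmetricBody.exceptional d)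
    (T : Finset (EuclideanSpace ℝ (Fin d))) (hT : ∀ u ∈ T, N.toSeminorm u = 1)
    (hneg : ∀ u ∈ T, -u ∉ T) :
    T.card ≤ d * Module.finrank ℚ (Submodule.span ℚ (T : Set (EuclideanSpace ℝ (Fin d)))) := by
  by_contra! hlt
  have : Module.Finite ℚ (Submodule.span ℚ (T : Set (EuclideanSpace ℝ (Fin d)))) :=
    Module.Finite.span_finset ℚ T
  let b := Module.finBasis ℚ (Submodule.span ℚ (T : Set (EuclideanSpace ℝ (Fin d))))
  let e := T.equivFin.symm
  let A : Matrix (Fin T.card) (Fin _) ℚ := fun r j =>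
    b.repr ⟨e r, Submodule.subset_span (e r).2⟩ j
  have hsep : ∀ r s, ∃ m : ℕ, r ≠ s → 1 / ((m : ℝ) + 1) ≤ ‖(e r).1 - (e s).1‖ ∧
      1 / ((m : ℝ) + 1) ≤ ‖(e r).1 + (e s).1‖ := fun r s => by
    by_cases hrs : r = s
    · exact ⟨0, fun h => absurd hrs h⟩
    have h1 : 0 < ‖(e r).1 - (e s).1‖ := norm_pos_iff.2
      (sub_ne_zero.2 fun h => hrs (e.injective (Subtype.ext h)))
    have h2 : 0 < ‖(e r).1 + (e s).1‖ := norm_pos_iff.2 fun h =>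
      hneg _ (e s).2 (by rw [← eq_neg_of_add_eq_zero_left h]; exact (e r).2)
    obtain ⟨m, hm⟩ := exists_nat_one_div_lt (lt_min h1 h2)
    exact ⟨m, fun _ => ⟨(hm.trans_le (min_le_left _ _)).le, (hm.trans_le (min_le_right _ _)).le⟩⟩
  choose m hm using hsep
  let M : ℕ := Finset.univ.sup fun p : Fin T.card × Fin T.card => m p.1 p.2
  have hM : ∀ r s, 1 / ((M : ℝ) + 1) ≤ 1 / ((m r s : ℝ) + 1) := fun r s => by
    have : m r s ≤ M :=
      Finset.le_sup (f := fun p : Fin T.card × Fin T.card => m p.1 p.2) (Finset.mem_univ (r, s))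
    exact Nat.one_div_le_one_div this
  refine hN ?_
  simp only [SymmetricBody.exceptional, Set.mem_iUnion]
  refine ⟨_, _, A, hlt, M, fun r => (e r).1, mem_rationalTuples (fun j => (b j).1) fun r => ?_,
    fun r => ⟨(hT _ (e r).2).le, N.notMem_interior_unitBall (hT _ (e r).2)⟩,
    fun r s hrs => ⟨(hM r s).trans (hm r s hrs).1, (hM r s).trans (hm r s hrs).2⟩⟩
  have := congrArg Subtype.val (b.sum_repr ⟨e r, Submodule.subset_span (e r).2⟩)
  simpa only [AddSubmonoidClass.coe_finsetSum, SetLike.val_smul] using this.symm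

/-- A set of representatives, up to sign, of the unit vectors that are differences of points of
`P`. -/
theorem exists_unitDifferences (P : Finset (EuclideanSpace ℝ (Fin d))) :
    ∃ S : Finset (EuclideanSpace ℝ (Fin d)), (∀ u ∈ S, N.toSeminorm u = 1) ∧ (∀ u ∈ S, -u ∉ S) ∧
      ∀ x ∈ P, ∀ y ∈ P, N.toSeminorm (x - y) = 1 → x - y ∈ S ∨ y - x ∈ S := by
  classical
  let D := {u ∈ (P ×ˢ P).image fun p => p.1 - p.2 | N.toSeminorm u = 1}
  -- With `S` of maximal size, a unit difference missing from `S` together with its negative could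
  -- be added to it.
  obtain ⟨S, hS, hmax⟩ := {S ∈ D.powerset | ∀ u ∈ S, -u ∉ S}.exists_max_image Finset.card
    ⟨∅, by simp⟩
  rw [Finset.mem_filter, Finset.mem_powerset] at hS
  refine ⟨S, fun u hu => (Finset.mem_filter.1 (hS.1 hu)).2, hS.2, fun x hx y hy hxy => ?_⟩
  by_contra! h
  have hD : x - y ∈ D :=
    Finset.mem_filter.2 ⟨Finset.mem_image.2 ⟨(x, y), Finset.mem_product.2 ⟨hx, hy⟩, rfl⟩, hxy⟩
  have hne : -(x - y) ≠ x - y := fun h0 => by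
    have h1 : (2 : ℝ) • (x - y) = 0 := by
      rw [two_smul]
      nth_rw 1 [← h0]
      exact neg_add_cancel _
    rw [(smul_eq_zero.1 h1).resolve_left two_ne_zero, map_zero] at hxy
    exact zero_ne_one hxy
  have := hmax (insert (x - y) S) (by
    rw [Finset.mem_filter, Finset.mem_powerset]
    refine ⟨Finset.insert_subset hD hS.1, fun u hu hu' => ?_⟩
    rw [Finset.mem_insert] at hu hu'
    rcases hu with rfl | hu <;> rcases hu' with hu' | hu'
    · exact hne hu'
    · exact h.2 (by rwa [neg_sub] at hu')
    · exact h.2 (by rwa [← neg_sub, ← hu', neg_neg])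
    · exact hS.2 u hu hu')
  rw [Finset.card_insert_of_notMem h.1] at this
  omega

open Classical in
theorem numUnitDistances_le_sum_translateCount {P S : Finset (EuclideanSpace ℝ (Fin d))}
    (hS : ∀ x ∈ P, ∀ y ∈ P, N.toSeminorm (x - y) = 1 → x - y ∈ S ∨ y - x ∈ S) :
    N.numUnitDistances P ≤ ∑ u ∈ S, translateCount P u := by
  let F := (S.sigma fun u => {x ∈ P | x + u ∈ P}).image fun p => s(p.2, p.2 + p.1)
  have hF : Sym2.map Subtype.val ''
      (N.unitDistanceGraph.induce (P : Set (EuclideanSpace ℝ (Fin d)))).edgeSet ⊆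
      (F : Set (Sym2 (EuclideanSpace ℝ (Fin d)))) := by
    rintro _ ⟨z, hz, rfl⟩
    induction z using Sym2.ind with
    | _ x y =>
    have hxy : N.toSeminorm (x.1 - y.1) = 1 := hz
    have hx : x.1 ∈ P := x.2
    have hy : y.1 ∈ P := y.2
    simp only [F, Sym2.map_mk, Finset.coe_image, Set.mem_image, Finset.mem_coe, Finset.mem_sigma,
      Finset.mem_filter]
    rcases hS x hx y hy hxy with h | h
    · exact ⟨⟨x.1 - y.1, y.1⟩, ⟨h, hy, by simp⟩, by simp [Sym2.eq_swap]⟩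
    · exact ⟨⟨y.1 - x.1, x.1⟩, ⟨h, hx, by simp⟩, by simp⟩
  calc N.numUnitDistances P = _ :=
        (Set.ncard_image_of_injective _ (Sym2.map.injective Subtype.val_injective)).symm
    _ ≤ F.card := by
        rw [← Set.ncard_coe_finset]
        exact Set.ncard_le_ncard hF F.finite_toSet
    _ ≤ _ := Finset.card_image_le
    _ = _ := Finset.card_sigma _ _

end DNorm

theorem theorem1p1 (d : ℕ) (hd : 2 ≤ d) :
    ∃ M : Set (SymmetricBody d), IsMeagre M ∧
      ∀ N : DNorm d, N.unitBall ∉ M →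
        ∀ n : ℕ, 1 ≤ n → ∀ P : Finset (EuclideanSpace ℝ (Fin d)), P.card = n →
          (N.numUnitDistances P : ℝ) ≤ (d : ℝ) / 2 * n * Real.logb 2 n := by
  classical
  refine ⟨_, SymmetricBody.isMeagre_exceptional d, fun N hN n _ P hP => ?_⟩
  obtain ⟨S, hS1, hneg, hS⟩ := N.exists_unitDifferences P
  obtain ⟨I, -, hI, hSI⟩ := exists_linearIndepOn_sum_le d (translateCount P) S fun T hT =>
    N.card_le_mul_finrank_span hN T (fun u hu => hS1 u (hT hu))
      fun u hu hu' => hneg u (hT hu) (hT hu')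
  have h1 : (N.numUnitDistances P : ℝ) ≤ d * ((∑ u ∈ I, translateCount P u : ℕ) : ℝ) := by
    exact_mod_cast (N.numUnitDistances_le_sum_translateCount hS).trans hSI
  have h2 := mul_le_mul_of_nonneg_left (two_mul_sum_translateCount_le I hI P) (Nat.cast_nonneg d)
  rw [hP] at h2
  linarith
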